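/- Let $\mathbb K$ be a field of characteristic zero. A partition of a finite linearly ordered set is noncrossing if there are no $a<c<b<d$ with $a,b$ in one block and $c,d$ in a different block; partitions are identified when they correspond under a monotone bijection of the underlying sets. Let $\mathrm{NCP}$ be the set of nonempty noncrossing partitions. Write $P\le Q$ if $P$ is finer than $Q$ (on the same underlying set), and $P_{|X}$ for the partition induced by $P$ on a subset $X$. *The Hopf algebra $H=H^{NC}_{gap}$.* As an algebra, $H$ is the free associative algebra on $\mathrm{NCP}$, the empty partition being identified with the unit; $\varepsilon:H\to\mathbb K$ is the character that vanishes on $\mathrm{NCP}$, and $H_+=\ker\varepsilon$. A cut $(L,U)$ of $P$ is a splitting of the set of blocks of $P$ into $L$ and its complement $U$ such that whenever $\pi\in U$ and the convex hull of $\pi$ meets a block $\rho$, also $\rho\in U$. If $x_1<\dots<x_k$ are the elements of the blocks in $L$, let $D_i=\{y : x_i<y<x_{i+1}\}$ for $0\le i\le k$ (with no lower bound for $i=0$ and no upper bound for $i=k$), and put $\overline U=P_{|D_0}\cdots P_{|D_k}\in H$, where empty factors are the unit. The coproduct is the algebra morphism $\Delta:H\to H\otimes H$ with $\Delta(P)=\sum_{(L,U)}L\otimes\overline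 U$ (sum over all cuts of $P$, where $L$ stands for the partition formed by its blocks). The left half-unshuffle coproduct is the linear map $\Delta_\prec:H_+\to H\otimes H$ with $\Delta_\prec(P)=\sum_{(L,U),\,1\in L}L\otimes\overline U$ for $P\in\mathrm{NCP}$, where the sum is over the cuts for which the smallest element $1$ of the underlying set lies in a block of $L$, and $\Delta_\prec(P\cdot w)=\Delta_\prec(P)\Delta(w)$ for $P\in\mathrm{NCP}$, $w\in H$. For linear forms $\kappa,\phi$ on $H$ with $\kappa(\mathbf 1)=0$, the linear form $\kappa\prec\phi$ is $(\kappa\otimes\phi)\circ\Delta_\prec$ on $H_+$, and $(\kappa\prec\phi)(\mathbf 1)=0$. Let $G$ be the set of characters of $H$ (unital algebra morphisms $H\to\mathbb K$), and $\mathfrak g$ the space of infinitesimal characters (linear forms on $H$ that vanish on $\mathbf 1$ and on $H_+\cdot H_+$). For every $\kappa\in\mathfrak g$ the equation $\phi=\varepsilon+\kappa\prec\phi$ has a unique solution $\phi\in G$, denoted by $\mathcal E_\prec(\kappa)$. *The algebra $B=B^{NC}_{bl}$ and its action.* As an algebra, $B$ is the free commutative algebra on $\mathrm{NCP}$; its counit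 is the character with value $1$ on partitions with one block and $0$ on all other elements of $\mathrm{NCP}$. For noncrossing $P\le Q$ put $P/Q=\prod_{\tau}P_{|\tau}\in B$, the product over the blocks $\tau$ of $Q$. The coaction is the algebra morphism $\rho:H\to H\otimes B$ with $\rho(P)=\sum_{P\le Q}Q\otimes P/Q$ for $P\in\mathrm{NCP}$ (sum over the noncrossing $Q\geq P$). For a linear form $\alpha$ on $H$ and a character $K$ of $B$ put $\alpha\curvearrowleft K=(\alpha\otimes K)\circ\rho$. Let $e\in\mathfrak g$ be the infinitesimal character that agrees on $\mathrm{NCP}$ with the counit of $B$ ($e(P)=1$ if $P$ has one block, and $e(P)=0$ otherwise), and put $\psi_\prec=\mathcal E_\prec(e)$. **Theorem.** Let $\kappa\in\mathfrak g$, and let $K$ be the character of $B$ with $K(P)=\kappa(P)$ for all $P\in\mathrm{NCP}$. Then for every character $\phi\in G$, $$\phi=\varepsilon+\kappa\prec\phi\iff\phi=\psi_\prec\curvearrowleft K .$$ In other words, $\mathcal E_\prec(\kappa)=\psi_\prec\curvearrowleft K$. -/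

import Mathlib

open scoped TensorProduct

noncomputable section

namespace NoncrossingHopf

/-! ### Noncrossing partitions

A partition of the linearly ordered set `Fin n` is an equivalence relation on `Fin n`; its blocks are
the equivalence classes. The order on `Setoid (Fin n)` is refinement: `r ≤ s` means that `r` is finer
than `s`. -/

/-- There are no `a < c < b < d` with `a, b` in one block and `c, d` in a different one. -/
def IsNoncrossing {n : ℕ} (r : Setoid (Fin n)) : Prop :=
  ∀ a b c d : Fin n, a < c → c < b → b < d → r a b → r c d → r a c

/-- The partition induced by `r` on a subset `S` of `Fin n`, standardized, that is, transported to
`Fin S.card` along the unique monotone bijection. -/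
def restrict {n : ℕ} (r : Setoid (Fin n)) (S : Finset (Fin n)) : Setoid (Fin S.card) :=
  r.comap (S.orderEmbOfFin rfl)

theorem IsNoncrossing.restrict {n : ℕ} {r : Setoid (Fin n)} (hr : IsNoncrossing r)
    (S : Finset (Fin n)) : IsNoncrossing (restrict r S) := by
  intro a b c d hac hcb hbd hab hcd
  exact hr _ _ _ _ ((S.orderEmbOfFin rfl).strictMono hac) ((S.orderEmbOfFin rfl).strictMono hcb)
    ((S.orderEmbOfFin rfl).strictMono hbd) hab hcd

/-- Nonempty (standard) noncrossing partitions. -/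
structure NCP where
  /-- the number of elements of the underlying set -/
  deg : ℕ
  deg_pos : 0 < deg
  rel : Setoid (Fin deg)
  noncrossing : IsNoncrossing rel

namespace NCP

/-- The smallest element of the underlying set (the element `1` of `[n]`). -/
def first (P : NCP) : Fin P.deg := ⟨0, P.deg_pos⟩

/-- The number of blocks. -/
def numBlocks (P : NCP) : ℕ := Nat.card (Quotient P.rel)

/-- The standardized restriction of `P` to a nonempty subset of its underlying set. -/
def restr (P : NCP) (S : Finset (Fin P.deg)) (hS : S.Nonempty) : NCP :=
  ⟨S.card, hS.card_pos, restrict P.rel S, P.noncrossing.restrict S⟩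

/-- The convex hull of the block of `a` meets the block of `b`. -/
def Nests (P : NCP) (a b : Fin P.deg) : Prop :=
  ∃ x y z : Fin P.deg, P.rel a x ∧ P.rel a y ∧ P.rel b z ∧ x ≤ z ∧ z ≤ y

/-- `U` is the underlying set of points of an upperset of blocks: if `U` contains a block `π` and
`Conv π` meets a block `ρ`, then `U` contains `ρ`. (As `Nests` contains the relation of being in the
same block, such a `U` is a union of blocks.) -/
def IsUpperset (P : NCP) (U : Finset (Fin P.deg)) : Prop :=
  ∀ a ∈ U, ∀ b, P.Nests a b → b ∈ U

open Classical in
/-- The cuts `(L, U)` of `P`, each given by the underlying set of the upperset `U`; the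
lowerset is the complement `L = Uᶜ`. -/
def cuts (P : NCP) : Finset (Finset (Fin P.deg)) :=
  Finset.univ.filter P.IsUpperset

/-- For `L = {x₁ < ⋯ < x_k}`, the interval of those `y` with `x_i < y < x_{i+1}`
(`y < x₁` for `i = 0`, and `y > x_k` for `i = k`). -/
def gap {n : ℕ} (L : Finset (Fin n)) (i : ℕ) : Finset (Fin n) :=
  Finset.univ.filter fun y => y ∉ L ∧ (L.filter (· < y)).card = i

open Classical in
/-- The underlying set of a block. -/
def block (Q : NCP) (q : Quotient Q.rel) : Finset (Fin Q.deg) :=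
  Finset.univ.filter fun x => Quotient.mk Q.rel x = q

theorem block_nonempty (Q : NCP) (q : Quotient Q.rel) : (Q.block q).Nonempty := by
  obtain ⟨x, hx⟩ := Quotient.exists_rep q
  exact ⟨x, by simp [block, hx]⟩

/-- The noncrossing partitions of the underlying set of `P` that are coarser than (or equal to)
`P`. -/
def Coarsening (P : NCP) : Type :=
  {r : Setoid (Fin P.deg) // IsNoncrossing r ∧ P.rel ≤ r}

/-- A coarsening of `P`, as a noncrossing partition. -/
def Coarsening.toNCP {P : NCP} (Q : P.Coarsening) : NCP :=
  ⟨P.deg, P.deg_pos, Q.1, Q.2.1⟩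

instance (P : NCP) : Finite P.Coarsening :=
  Finite.of_injective (fun Q : P.Coarsening => fun a b : Fin P.deg => Q.1 a b) fun _ _ h =>
    Subtype.ext (Setoid.ext fun a b => iff_of_eq (congrFun (congrFun h a) b))

instance (P : NCP) : Fintype P.Coarsening := Fintype.ofFinite _

instance (P : NCP) : Fintype (Quotient P.rel) := Fintype.ofFinite _

end NCP

/-! ### The Hopf algebra of noncrossing partitions (gap insertion) -/

section

variable (𝕂 : Type*) [Field 𝕂]

/-- As an algebra, the free associative algebra on the nonempty noncrossing partitions; the empty
partition is identified with the unit. -/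
abbrev HGap : Type _ := FreeAlgebra 𝕂 NCP

/-- As an algebra, the free commutative algebra on the nonempty noncrossing partitions. -/
abbrev BBl : Type _ := MvPolynomial NCP 𝕂

/-- Linear forms on `HGap`. -/
abbrev LinForm : Type _ := HGap 𝕂 →ₗ[𝕂] 𝕂

/-- Characters of `HGap`. -/
abbrev CharH : Type _ := HGap 𝕂 →ₐ[𝕂] 𝕂

/-- Characters of `BBl`. -/
abbrev CharB : Type _ := BBl 𝕂 →ₐ[𝕂] 𝕂

/-- The counit of `HGap`: it vanishes on all nonempty partitions. -/
def counitH : CharH 𝕂 := FreeAlgebra.lift 𝕂 fun _ => 0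

open Classical in
/-- The counit of `BBl`: it is `1` on one-block partitions and `0` on all other partitions. -/
def counitB : CharB 𝕂 := MvPolynomial.aeval fun P => if P.numBlocks = 1 then 1 else 0

variable {𝕂}

open Classical in
/-- The class in `HGap` of the standardized restriction of `P` to `S` (the unit if `S` is empty). -/
def st (P : NCP) (S : Finset (Fin P.deg)) : HGap 𝕂 :=
  if hS : S.Nonempty then FreeAlgebra.ι 𝕂 (P.restr S hS) else 1

/-- The reduced gap monomial of the cut with upperset `U`: the ordered product of the restrictions of
`P` to the gaps `D₀, …, D_k` of the lowerset `Uᶜ`. -/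
def gapMonomial (P : NCP) (U : Finset (Fin P.deg)) : HGap 𝕂 :=
  ((List.range (Uᶜ.card + 1)).map fun i => st P (NCP.gap Uᶜ i)).prod

variable (𝕂)

/-- The coproduct `Δ`: on partitions it is `Δ(P) = ∑ L ⊗ U` over all cuts, where `U` stands for
the reduced gap monomial, and it is extended multiplicatively. -/
def coprod : HGap 𝕂 →ₐ[𝕂] HGap 𝕂 ⊗[𝕂] HGap 𝕂 :=
  FreeAlgebra.lift 𝕂 fun P => ∑ U ∈ P.cuts, st P Uᶜ ⊗ₜ[𝕂] gapMonomial P U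

/-- The left half-unshuffle coproduct of a single partition: the sum over the cuts whose lowerset
contains the first element. -/
def leftCoprodNCP (P : NCP) : HGap 𝕂 ⊗[𝕂] HGap 𝕂 :=
  ∑ U ∈ P.cuts with P.first ∈ Uᶜ, st P Uᶜ ⊗ₜ[𝕂] gapMonomial P U

/-- The left half-unshuffle coproduct `Δ_≺` on the augmentation ideal, which has the nonempty words
of partitions as a basis: cuts of a multipartition are taken factor by factor, and the first element
of the first factor has to be in the lowerset. We extend it by `0` to the empty word. -/
def leftCoprod : HGap 𝕂 →ₗ[𝕂] HGap 𝕂 ⊗[𝕂] HGap 𝕂 :=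
  (FreeAlgebra.basisFreeMonoid 𝕂 NCP).constr 𝕂 fun w =>
    match FreeMonoid.toList w with
    | [] => 0
    | P :: v => leftCoprodNCP 𝕂 P * coprod 𝕂 ((v.map (FreeAlgebra.ι 𝕂)).prod)

variable {𝕂}

/-- The left half-shuffle product of linear forms, dual to `Δ_≺`. It is only used for `f` with
`f 1 = 0`; then `f ≺ ε = f` and `ε ≺ f = 0`. -/
def leftShuffle (f g : LinForm 𝕂) : LinForm 𝕂 :=
  LinearMap.mul' 𝕂 𝕂 ∘ₗ TensorProduct.map f g ∘ₗ leftCoprod 𝕂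

/-- The monomial `P / Q` in `BBl`, for `P ≤ Q`: the product over the blocks `τ` of `Q` of the
standardized restrictions of `P` to `τ`. -/
def fibre (P : NCP) (Q : P.Coarsening) : BBl 𝕂 :=
  ∏ q : Quotient Q.toNCP.rel, MvPolynomial.X (P.restr (Q.toNCP.block q) (Q.toNCP.block_nonempty q))

variable (𝕂)

/-- The right coaction of `BBl` on `HGap`: on partitions it is `ρ(P) = ∑_{P ≤ Q} Q ⊗ P / Q`, and it
is extended multiplicatively. -/
def coaction : HGap 𝕂 →ₐ[𝕂] HGap 𝕂 ⊗[𝕂] BBl 𝕂 :=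
  FreeAlgebra.lift 𝕂 fun P => ∑ Q : P.Coarsening, FreeAlgebra.ι 𝕂 Q.toNCP ⊗ₜ[𝕂] fibre P Q

variable {𝕂}

/-- The right action `α ↶ φ = (α ⊗ φ) ∘ ρ` of characters of `BBl` on linear forms on `HGap`. -/
def act (α : LinForm 𝕂) (φ : CharB 𝕂) : LinForm 𝕂 :=
  LinearMap.mul' 𝕂 𝕂 ∘ₗ TensorProduct.map α φ.toLinearMap ∘ₗ (coaction 𝕂).toLinearMap

variable (𝕂)

/-- The infinitesimal characters of `HGap`: the linear forms that vanish on the unit and on products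
of two elements of the augmentation ideal. -/
def InfChar : Submodule 𝕂 (LinForm 𝕂) where
  carrier := {κ | κ 1 = 0 ∧ ∀ x y, counitH 𝕂 x = 0 → counitH 𝕂 y = 0 → κ (x * y) = 0}
  zero_mem' := by simp
  add_mem' := by
    rintro a b ⟨ha, ha'⟩ ⟨hb, hb'⟩
    exact ⟨by simp [ha, hb], fun x y hx hy => by simp [ha' x y hx hy, hb' x y hx hy]⟩
  smul_mem' := by
    rintro c a ⟨ha, ha'⟩
    exact ⟨by simp [ha], fun x y hx hy => by simp [ha' x y hx hy]⟩

variable {𝕂}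

/-- The character `Θ(κ)` of `HGap` that agrees with `κ` on all partitions. -/
def Theta (κ : InfChar 𝕂) : CharH 𝕂 :=
  FreeAlgebra.lift 𝕂 fun P => κ.1 (FreeAlgebra.ι 𝕂 P)

/-- The character of `BBl` that agrees on all partitions with the character `φ` of `HGap`. -/
def bar (φ : CharH 𝕂) : CharB 𝕂 :=
  MvPolynomial.aeval fun P => φ (FreeAlgebra.ι 𝕂 P)

/-- The linear form with prescribed values on partitions that vanishes on all words of length
different from `1`. -/
def extendForm (f : NCP → 𝕂) : LinForm 𝕂 :=
  (FreeAlgebra.basisFreeMonoid 𝕂 NCP).constr 𝕂 fun w =>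
    match FreeMonoid.toList w with
    | [P] => f P
    | _ => 0

theorem basisFreeMonoid_apply (w : FreeMonoid NCP) :
    FreeAlgebra.basisFreeMonoid 𝕂 NCP w
      = ((FreeMonoid.toList w).map (FreeAlgebra.ι 𝕂)).prod := by
  have h : FreeAlgebra.basisFreeMonoid 𝕂 NCP w
      = FreeAlgebra.equivMonoidAlgebraFreeMonoid.symm (MonoidAlgebra.single w 1) := rfl
  rw [h]
  simp [FreeAlgebra.equivMonoidAlgebraFreeMonoid, MonoidAlgebra.lift_single, FreeMonoid.lift_apply]

theorem counitH_basis (w : FreeMonoid NCP) :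
    counitH 𝕂 (FreeAlgebra.basisFreeMonoid 𝕂 NCP w) = match FreeMonoid.toList w with
        | [] => 1
        | _ => 0 := by
  rw [basisFreeMonoid_apply]
  induction w using FreeMonoid.casesOn with
  | one => simp
  | of_mul P v => simp [counitH]

theorem InfChar.mul_left (κ : InfChar 𝕂) {a : HGap 𝕂} (ha : counitH 𝕂 a = 0) (c : HGap 𝕂) :
    κ.1 (a * c) = κ.1 a * counitH 𝕂 c := by
  have h := κ.2.2 a (c - algebraMap 𝕂 _ (counitH 𝕂 c)) ha (by simp)
  rw [mul_sub, map_sub, sub_eq_zero] at h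
  rw [h, ← Algebra.commutes, ← Algebra.smul_def, map_smul, smul_eq_mul, mul_comm]

theorem extendForm_basis (f : NCP → 𝕂) (w : FreeMonoid NCP) :
    extendForm f (FreeAlgebra.basisFreeMonoid 𝕂 NCP w)
      = match FreeMonoid.toList w with
        | [P] => f P
        | _ => 0 := by
  simp [extendForm]

theorem extendForm_mem (f : NCP → 𝕂) : extendForm f ∈ InfChar 𝕂 := by
  have key : ∀ x y : HGap 𝕂, extendForm f (x * y)
      = extendForm f x * counitH 𝕂 y + counitH 𝕂 x * extendForm f y := by
    intro x y
    have : (LinearMap.mul 𝕂 (HGap 𝕂)).compr₂ (extendForm f)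
        = (LinearMap.mul 𝕂 𝕂).compl₁₂ (extendForm f) (counitH 𝕂).toLinearMap
          + (LinearMap.mul 𝕂 𝕂).compl₁₂ (counitH 𝕂).toLinearMap (extendForm f) := by
      refine (FreeAlgebra.basisFreeMonoid 𝕂 NCP).ext fun v =>
        (FreeAlgebra.basisFreeMonoid 𝕂 NCP).ext fun w => ?_
      have hm : FreeAlgebra.basisFreeMonoid 𝕂 NCP v * FreeAlgebra.basisFreeMonoid 𝕂 NCP w
          = FreeAlgebra.basisFreeMonoid 𝕂 NCP (v * w) := by
        simp [basisFreeMonoid_apply]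
      simp only [LinearMap.compr₂_apply, LinearMap.mul_apply', LinearMap.add_apply,
        LinearMap.compl₁₂_apply, AlgHom.toLinearMap_apply, hm, extendForm_basis, counitH_basis]
      induction v using FreeMonoid.casesOn with
      | one => simp
      | of_mul P v =>
        induction w using FreeMonoid.casesOn with
        | one => simp
        | of_mul Q w => rcases h : FreeMonoid.toList v with _ | ⟨R, t⟩ <;> simp [h]
    exact LinearMap.congr_fun (LinearMap.congr_fun this x) y
  refine ⟨?_, fun x y hx hy => by rw [key, hx, hy]; simp⟩
  have := key 1 1
  simpa using this

/-- The inverse of `Θ`: the infinitesimal character of `HGap` that agrees with `φ` on all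
partitions. -/
def thetaInv (φ : CharH 𝕂) : InfChar 𝕂 :=
  ⟨extendForm fun P => φ (FreeAlgebra.ι 𝕂 P), extendForm_mem _⟩

theorem Theta_thetaInv (φ : CharH 𝕂) : Theta (thetaInv φ) = φ := by
  refine FreeAlgebra.hom_ext (funext fun P => ?_)
  have h := extendForm_basis (fun P => φ (FreeAlgebra.ι 𝕂 P)) (FreeMonoid.of P)
  simpa [Theta, thetaInv, basisFreeMonoid_apply] using h

theorem thetaInv_Theta (κ : InfChar 𝕂) : thetaInv (Theta κ) = κ := by
  refine Subtype.ext ((FreeAlgebra.basisFreeMonoid 𝕂 NCP).ext fun w => ?_)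
  simp only [thetaInv, extendForm_basis]
  induction w using FreeMonoid.casesOn with
  | one => simp [basisFreeMonoid_apply, κ.2.1]
  | of_mul P v =>
    have h := InfChar.mul_left κ (a := FreeAlgebra.ι 𝕂 P) (by simp [counitH])
      (FreeAlgebra.basisFreeMonoid 𝕂 NCP v)
    rw [counitH_basis] at h
    have hm : FreeAlgebra.basisFreeMonoid 𝕂 NCP (FreeMonoid.of P * v)
        = FreeAlgebra.ι 𝕂 P * FreeAlgebra.basisFreeMonoid 𝕂 NCP v := by
      simp [basisFreeMonoid_apply]
    rw [hm, h]
    rcases hv : FreeMonoid.toList v with _ | ⟨Q, t⟩ <;> simp [hv, Theta]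

/-- The character of `HGap` that agrees on all partitions with the character `ψ` of `BBl`. -/
def hat (ψ : CharB 𝕂) : CharH 𝕂 :=
  FreeAlgebra.lift 𝕂 fun P => ψ (MvPolynomial.X P)

/-- The left half-shuffle fixpoint equation `φ = ε + κ ≺ φ`. -/
def IsLeftFixpoint (κ φ : LinForm 𝕂) : Prop :=
  φ = (counitH 𝕂).toLinearMap + leftShuffle κ φ

/-! ### Existence of a character that solves the left half-shuffle fixpoint equation -/

theorem counitH_st (P : NCP) (S : Finset (Fin P.deg)) (hS : S.Nonempty) :
    counitH 𝕂 (st P S) = 0 := by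
  simp [st, hS, counitH]

theorem counitH_map_coprod (φ : CharH 𝕂) (x : HGap 𝕂) :
    LinearMap.mul' 𝕂 𝕂
      (TensorProduct.map (counitH 𝕂).toLinearMap φ.toLinearMap (coprod 𝕂 x)) = φ x := by
  have h : ((Algebra.TensorProduct.lmul' 𝕂 (S := 𝕂)).comp
      (Algebra.TensorProduct.map (counitH 𝕂) φ)).comp (coprod 𝕂) = φ := by
    refine FreeAlgebra.hom_ext (funext fun P => ?_)
    simp only [Function.comp_apply, AlgHom.comp_apply, coprod, FreeAlgebra.lift_ι_apply, map_sum,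
      Algebra.TensorProduct.map_tmul, Algebra.TensorProduct.lmul'_apply_tmul]
    rw [Finset.sum_eq_single Finset.univ]
    · have hg : NCP.gap (∅ : Finset (Fin P.deg)) 0 = Finset.univ := by
        ext; simp [NCP.gap]
      have hs : st (𝕂 := 𝕂) P Finset.univ = FreeAlgebra.ι 𝕂 P := by
        have hne : (Finset.univ : Finset (Fin P.deg)).Nonempty := ⟨P.first, by simp⟩
        rw [st, dif_pos hne]
        congr 1
        obtain ⟨n, hn, r, hr⟩ := P
        simp only [NCP.restr]
        have hc : (Finset.univ : Finset (Fin n)).card = n := by simp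
        have : ∀ (m : ℕ) (h : (Finset.univ : Finset (Fin n)).card = m) (hm : 0 < m)
            (hnc : IsNoncrossing (r.comap ((Finset.univ : Finset (Fin n)).orderEmbOfFin h))),
            (m = n) → (⟨m, hm, r.comap ((Finset.univ : Finset (Fin n)).orderEmbOfFin h), hnc⟩ : NCP)
              = ⟨n, hn, r, hr⟩ := by
          intro m h hm hnc hmn
          subst hmn
          congr 1
          have : (Finset.univ : Finset (Fin m)).orderEmbOfFin h = RelEmbedding.refl _ :=
            (Finset.orderEmbOfFin_unique' h fun _ => Finset.mem_univ _).symm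
          rw [this]
          rfl
        exact this _ rfl _ _ hc
      have he : st (𝕂 := 𝕂) P ∅ = 1 := by simp [st]
      simp [gapMonomial, hg, hs, he]
    · intro U hU hne
      rw [counitH_st, zero_mul]
      rw [Finset.nonempty_iff_ne_empty]
      simpa using hne
    · intro h
      refine absurd ?_ h
      simp [NCP.cuts, NCP.IsUpperset]
  have h2 : LinearMap.mul' 𝕂 𝕂 ∘ₗ TensorProduct.map (counitH 𝕂).toLinearMap φ.toLinearMap
      = ((Algebra.TensorProduct.lmul' 𝕂 (S := 𝕂)).comp
          (Algebra.TensorProduct.map (counitH 𝕂) φ)).toLinearMap := by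
    ext <;> simp
  have h3 := LinearMap.congr_fun h2 (coprod 𝕂 x)
  simp only [LinearMap.comp_apply] at h3
  rw [h3]
  exact DFunLike.congr_fun h x

/-- The value of `κ ≺ φ` on a single partition. -/
def fixStep (κ : InfChar 𝕂) (φ : CharH 𝕂) (P : NCP) : 𝕂 :=
  ∑ U ∈ P.cuts with P.first ∈ Uᶜ, κ.1 (st P Uᶜ) * φ (gapMonomial P U)

theorem leftShuffle_word (κ : InfChar 𝕂) (φ : CharH 𝕂) (P : NCP) (v : FreeMonoid NCP) :
    leftShuffle κ.1 φ.toLinearMap (FreeAlgebra.basisFreeMonoid 𝕂 NCP (FreeMonoid.of P * v))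
      = fixStep κ φ P * φ (FreeAlgebra.basisFreeMonoid 𝕂 NCP v) := by
  have key : ∀ (a b : HGap 𝕂) (_ : counitH 𝕂 a = 0) (y : HGap 𝕂 ⊗[𝕂] HGap 𝕂),
      LinearMap.mul' 𝕂 𝕂 (TensorProduct.map κ.1 φ.toLinearMap ((a ⊗ₜ[𝕂] b) * y))
        = κ.1 a * φ b * LinearMap.mul' 𝕂 𝕂
            (TensorProduct.map (counitH 𝕂).toLinearMap φ.toLinearMap y) := by
    intro a b ha y
    induction y using TensorProduct.induction_on with
    | zero => simp
    | tmul c d =>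
      simp [InfChar.mul_left κ ha]
      ring
    | add c d hc hd => simp only [mul_add, map_add, hc, hd]
  simp only [leftShuffle, LinearMap.comp_apply, leftCoprod, Module.Basis.constr_basis]
  simp only [FreeMonoid.toList_of_mul, leftCoprodNCP, Finset.sum_mul, map_sum, fixStep]
  refine Finset.sum_congr rfl fun U hU => ?_
  rw [key _ _ (counitH_st P _ ⟨_, (Finset.mem_filter.1 hU).2⟩), counitH_map_coprod,
    basisFreeMonoid_apply]

theorem fixStep_congr (κ : InfChar 𝕂) (φ χ : CharH 𝕂) (P : NCP)
    (h : ∀ Q : NCP, Q.deg < P.deg → φ (FreeAlgebra.ι 𝕂 Q) = χ (FreeAlgebra.ι 𝕂 Q)) :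
    fixStep κ φ P = fixStep κ χ P := by
  refine Finset.sum_congr rfl fun U hU => ?_
  have hf := (Finset.mem_filter.1 hU).2
  congr 1
  simp only [gapMonomial, map_list_prod, List.map_map]
  congr 1
  refine List.map_congr_left fun i _ => ?_
  simp only [Function.comp_apply, st]
  split_ifs with hS
  · refine h _ ?_
    have hlt : (NCP.gap Uᶜ i).card < (Finset.univ : Finset (Fin P.deg)).card := by
      refine Finset.card_lt_card (Finset.ssubset_univ_iff.2 fun hu => ?_)
      have := hu ▸ Finset.mem_univ P.first
      simp only [NCP.gap, Finset.mem_filter] at this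
      exact this.2.1 hf
    rwa [Finset.card_fin] at hlt
  · simp

/-- Successive approximations of the solution of the fixpoint equation. -/
def approx (κ : InfChar 𝕂) : ℕ → CharH 𝕂
  | 0 => counitH 𝕂
  | n + 1 => FreeAlgebra.lift 𝕂 fun P => fixStep κ (approx κ n) P

theorem approx_succ (κ : InfChar 𝕂) (n : ℕ) (P : NCP) (hP : P.deg ≤ n) :
    approx κ (n + 1) (FreeAlgebra.ι 𝕂 P) = approx κ n (FreeAlgebra.ι 𝕂 P) := by
  induction n generalizing P with
  | zero => exact absurd P.deg_pos (by omega)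
  | succ n ih =>
    rw [approx, FreeAlgebra.lift_ι_apply]
    conv_rhs => rw [approx, FreeAlgebra.lift_ι_apply]
    exact fixStep_congr κ _ _ P fun Q hQ => ih Q (by omega)

theorem approx_stable (κ : InfChar 𝕂) (P : NCP) (n : ℕ) (hP : P.deg ≤ n) :
    approx κ n (FreeAlgebra.ι 𝕂 P) = approx κ P.deg (FreeAlgebra.ι 𝕂 P) := by
  induction n, hP using Nat.le_induction with
  | base => rfl
  | succ n hn ih => rw [approx_succ κ n P hn, ih]

theorem exists_leftFixpoint (κ : InfChar 𝕂) :
    ∃ φ : CharH 𝕂, IsLeftFixpoint κ.1 φ.toLinearMap := by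
  let φ : CharH 𝕂 := FreeAlgebra.lift 𝕂 fun P => approx κ P.deg (FreeAlgebra.ι 𝕂 P)
  have hφ : ∀ P, φ (FreeAlgebra.ι 𝕂 P) = fixStep κ φ P := by
    intro P
    obtain ⟨n, hn⟩ : ∃ n, P.deg = n + 1 := ⟨P.deg - 1, by have := P.deg_pos; omega⟩
    have h1 : φ (FreeAlgebra.ι 𝕂 P) = approx κ P.deg (FreeAlgebra.ι 𝕂 P) :=
      FreeAlgebra.lift_ι_apply _ _
    rw [h1, hn, approx, FreeAlgebra.lift_ι_apply]
    refine fixStep_congr κ _ _ P fun Q hQ => ?_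
    have h2 : φ (FreeAlgebra.ι 𝕂 Q) = approx κ Q.deg (FreeAlgebra.ι 𝕂 Q) :=
      FreeAlgebra.lift_ι_apply _ _
    rw [h2, approx_stable κ Q n (by omega)]
  refine ⟨φ, (FreeAlgebra.basisFreeMonoid 𝕂 NCP).ext fun w => ?_⟩
  induction w using FreeMonoid.casesOn with
  | one =>
    have h0 : leftCoprod 𝕂 (FreeAlgebra.basisFreeMonoid 𝕂 NCP 1) = 0 := by
      simp only [leftCoprod, Module.Basis.constr_basis]
      rfl
    simp only [LinearMap.add_apply, leftShuffle, LinearMap.comp_apply, h0]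
    simp [basisFreeMonoid_apply]
  | of_mul P v =>
    rw [LinearMap.add_apply, leftShuffle_word, AlgHom.toLinearMap_apply, AlgHom.toLinearMap_apply,
      counitH_basis, ← hφ P, ← map_mul]
    simp [basisFreeMonoid_apply]

/-- The left half-shuffle exponential `E_≺(κ)` of an infinitesimal character `κ`: the character
`φ` with `φ = ε + κ ≺ φ`. -/
def leftExp (κ : InfChar 𝕂) : CharH 𝕂 := (exists_leftFixpoint κ).choose

variable (𝕂)

/-- The infinitesimal character `e = Θ⁻¹(ε)` that corresponds to the counit `ε` of `BBl`: it is `1` on the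
partitions with one block, and `0` on all other partitions. -/
def unitInfChar : InfChar 𝕂 := thetaInv (hat (counitB 𝕂))

/-- The universal character `ψ_≺ = E_≺(e)`. -/
def psiLeft : CharH 𝕂 := leftExp (unitInfChar 𝕂)

end

end NoncrossingHopf

end

noncomputable section

namespace NoncrossingHopf

namespace NCP

/-! For a character `φ`, the fixpoint equation holds as soon as it holds on single partitions, where
it reads `φ(P) = ∑ κ(L) φ(D₀) ⋯ φ(D_k)`, over the cuts with the first element in `L`
(`isLeftFixpoint_iff`). The gaps are smaller than `P`, so the solution is unique
(`IsLeftFixpoint.unique`), and it suffices that `ψ_≺ ↶ K` is a solution.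

For `κ = e` the constant `1` solves this recursion: the only cut that contributes has the block of
the first element as its lowerset. Hence `ψ_≺` is `1` on every partition (`psiLeft_ι`), and `(ψ_≺ ↶
K)(P) = ∑_{Q ≥ P} ∏_{τ ∈ Q} κ(P|τ)`.

This sum satisfies the recursion for `κ` because of a bijection (`sum_families_univ`). In a
noncrossing `Q ≥ P`, the block `L` of the first element is the lowerset of a cut of `P`, and every
other block lies in a single gap of `L`. Conversely, noncrossing coarsenings chosen independently in
the gaps of such a cut assemble with `L` to a noncrossing `Q`.

To keep standardizations out of the bijection, a coarsening of a restriction of `P` is encoded as a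
family of subsets of `Fin P.deg` (`IsNCFamily`); `sum_coarsening` translates the sums. -/

/-! ### Standardization and iterated restriction -/

theorem ext_orderEmb {P R : NCP} (h : R.deg = P.deg) (e : Fin R.deg ↪o Fin P.deg)
    (he : R.rel = P.rel.comap e) : R = P := by
  obtain ⟨n, hn, r, hr⟩ := P
  obtain ⟨m, hm, s, hs⟩ := R
  dsimp only at h
  subst h
  dsimp only at e he
  -- The full set has only one increasing enumeration, so an order embedding of `Fin m` into itself
  -- is the identity.
  have : e = RelEmbedding.refl _ := by
    have h1 : ∀ f : Fin m ↪o Fin m, f = (Finset.univ : Finset (Fin m)).orderEmbOfFin (by simp) :=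
      fun f => Finset.orderEmbOfFin_unique' _ fun _ => Finset.mem_univ _
    rw [h1 e, ← h1]
  subst this
  have he' : s = r := he
  subst he'
  rfl

/-- Restricting in two stages is restricting once: both composites enumerate the image of `S`
increasingly, and such an enumeration is unique. -/
theorem restr_map {P R : NCP} (e : Fin R.deg ↪o Fin P.deg) (he : R.rel = P.rel.comap e)
    (S : Finset (Fin R.deg)) (hS : S.Nonempty)
    (hS' : (S.map e.toEmbedding).Nonempty) :
    R.restr S hS = P.restr (S.map e.toEmbedding) hS' := by
  have hc : (S.map e.toEmbedding).card = S.card := Finset.card_map _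
  refine ext_orderEmb hc.symm (Fin.castOrderIso hc.symm).toOrderEmbedding ?_
  have h1 := Finset.orderEmbOfFin_unique' (s := S.map e.toEmbedding) hc
    (f := (S.orderEmbOfFin rfl).trans e) (fun x => by simp)
  have h2 := Finset.orderEmbOfFin_unique' (s := S.map e.toEmbedding) hc
    (f := (Fin.castOrderIso hc.symm).toOrderEmbedding.trans
      ((S.map e.toEmbedding).orderEmbOfFin rfl)) (fun x => Finset.orderEmbOfFin_mem _ rfl _)
  have key : ∀ x, e (S.orderEmbOfFin rfl x)
      = (S.map e.toEmbedding).orderEmbOfFin rfl (Fin.cast hc.symm x) :=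
    DFunLike.congr_fun (h1.trans h2.symm)
  refine Setoid.ext fun (a b : Fin S.card) => ?_
  have h3 : R.rel (S.orderEmbOfFin rfl a) (S.orderEmbOfFin rfl b) ↔
      P.rel (e (S.orderEmbOfFin rfl a)) (e (S.orderEmbOfFin rfl b)) := by
    rw [he]
    rfl
  rw [key, key] at h3
  exact h3

/-! ### Coarsenings as families of blocks -/

/-- `π` is the set of blocks of a noncrossing partition of `S` that is coarser than the partition
induced by `P`. -/
structure IsNCFamily (P : NCP) (S : Finset (Fin P.deg)) (π : Finset (Finset (Fin P.deg))) :
    Prop where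
  nonempty : ∀ B ∈ π, B.Nonempty
  subset : ∀ B ∈ π, B ⊆ S
  cover : ∀ x ∈ S, ∃ B ∈ π, x ∈ B
  eq_of_mem : ∀ B ∈ π, ∀ C ∈ π, ∀ x, x ∈ B → x ∈ C → B = C
  saturated : ∀ B ∈ π, ∀ x ∈ B, ∀ y ∈ S, P.rel x y → y ∈ B
  noncrossing : ∀ B ∈ π, ∀ C ∈ π, ∀ a ∈ B, ∀ b ∈ B, ∀ c ∈ C, ∀ d ∈ C,
    a < c → c < b → b < d → B = C

open Classical in
/-- The block sets of the noncrossing coarsenings of the partition that `P` induces on `S`. -/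
def families (P : NCP) (S : Finset (Fin P.deg)) : Finset (Finset (Finset (Fin P.deg))) :=
  Finset.univ.filter (P.IsNCFamily S)

theorem mem_families {P : NCP} {S : Finset (Fin P.deg)} {π : Finset (Finset (Fin P.deg))} :
    π ∈ P.families S ↔ P.IsNCFamily S π := by
  simp [families]

theorem mem_block {Q : NCP} {q : Quotient Q.rel} {x : Fin Q.deg} :
    x ∈ Q.block q ↔ Quotient.mk Q.rel x = q := by
  simp [block]

open Classical in
/-- A block of a coarsening, transported along an order embedding. -/
def Coarsening.imageBlock {P R : NCP} (e : Fin R.deg ↪o Fin P.deg) (Q : R.Coarsening)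
    (q : Quotient Q.1) : Finset (Fin P.deg) :=
  Finset.univ.filter fun x => ∃ b : Fin R.deg, Quotient.mk Q.1 b = q ∧ e b = x

open Classical in
/-- The block set of a coarsening, transported along an order embedding. -/
def Coarsening.family {P R : NCP} (e : Fin R.deg ↪o Fin P.deg) (Q : R.Coarsening) :
    Finset (Finset (Fin P.deg)) :=
  Finset.univ.image (Q.imageBlock e)

theorem Coarsening.mem_family {P R : NCP} (e : Fin R.deg ↪o Fin P.deg) (Q : R.Coarsening)
    (B : Finset (Fin P.deg)) :
    B ∈ Q.family e ↔ ∃ a : Fin R.deg, Q.imageBlock e (Quotient.mk Q.1 a) = B := by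
  simp only [family, Finset.mem_image, Finset.mem_univ, true_and]
  constructor
  · rintro ⟨q, rfl⟩
    induction q using Quotient.inductionOn with
    | _ a => exact ⟨a, rfl⟩
  · rintro ⟨a, rfl⟩
    exact ⟨_, rfl⟩

theorem Coarsening.mem_imageBlock {P R : NCP} (e : Fin R.deg ↪o Fin P.deg) (Q : R.Coarsening)
    (a : Fin R.deg) (x : Fin P.deg) :
    x ∈ Q.imageBlock e (Quotient.mk Q.1 a) ↔ ∃ b : Fin R.deg, Q.1 b a ∧ e b = x := by
  simp only [imageBlock, Finset.mem_filter, Finset.mem_univ, true_and]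
  exact exists_congr fun b => and_congr_left fun _ => Quotient.eq

theorem Coarsening.imageBlock_nonempty {P R : NCP} (e : Fin R.deg ↪o Fin P.deg)
    (Q : R.Coarsening) (q : Quotient Q.1) : (Q.imageBlock e q).Nonempty := by
  induction q using Quotient.inductionOn with
  | _ a => exact ⟨e a, (Q.mem_imageBlock e a _).2 ⟨a, Q.1.refl a, rfl⟩⟩

theorem Coarsening.imageBlock_injective {P R : NCP} (e : Fin R.deg ↪o Fin P.deg)
    (Q : R.Coarsening) : Function.Injective (Q.imageBlock e) := by
  intro p q h
  induction p using Quotient.inductionOn with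
  | _ a =>
    have ha : e a ∈ Q.imageBlock e q := h ▸ (Q.mem_imageBlock e a _).2 ⟨a, Q.1.refl a, rfl⟩
    simp only [imageBlock, Finset.mem_filter, Finset.mem_univ, true_and] at ha
    obtain ⟨b, hb, hab⟩ := ha
    rw [← hb, e.injective hab]

theorem Coarsening.restr_block {P R : NCP} (e : Fin R.deg ↪o Fin P.deg)
    (he : R.rel = P.rel.comap e) (Q : R.Coarsening) (q : Quotient Q.1) :
    R.restr (Q.toNCP.block q) (Q.toNCP.block_nonempty q)
      = P.restr (Q.imageBlock e q) (Q.imageBlock_nonempty e q) := by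
  -- The block has type `Finset (Fin Q.toNCP.deg)`, which is `Finset (Fin R.deg)` only after
  -- unfolding; a general `S` with the same elements makes `restr_map` applicable.
  have key : ∀ (S : Finset (Fin R.deg)) (hS : S.Nonempty),
      (∀ x, x ∈ S ↔ Quotient.mk Q.1 x = q) →
      R.restr S hS = P.restr (Q.imageBlock e q) (Q.imageBlock_nonempty e q) := by
    intro S hS h
    have hm : S.map e.toEmbedding = Q.imageBlock e q := by
      ext x
      simp only [Finset.mem_map, h, imageBlock, Finset.mem_filter, Finset.mem_univ, true_and]
      rfl
    rw [restr_map e he S hS hS.map]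
    congr 1
  exact key _ _ fun _ => mem_block

theorem Coarsening.isNCFamily {P R : NCP} (e : Fin R.deg ↪o Fin P.deg)
    (he : R.rel = P.rel.comap e) (Q : R.Coarsening) :
    P.IsNCFamily (Finset.univ.map e.toEmbedding) (Q.family e) := by
  have hQ := Q.2
  have hblock : ∀ a b, Q.1 a b → Q.imageBlock e (Quotient.mk Q.1 a)
      = Q.imageBlock e (Quotient.mk Q.1 b) := fun a b h => by
    rw [show Quotient.mk Q.1 a = Quotient.mk Q.1 b from Quotient.sound h]
  constructor
  all_goals simp only [Coarsening.mem_family]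
  · rintro _ ⟨a, rfl⟩
    exact Q.imageBlock_nonempty e _
  · rintro _ ⟨a, rfl⟩
    intro x hx
    obtain ⟨b, -, rfl⟩ := (Q.mem_imageBlock e _ _).1 hx
    exact Finset.mem_map.2 ⟨b, Finset.mem_univ _, rfl⟩
  · intro x hx
    obtain ⟨a, -, rfl⟩ := Finset.mem_map.1 hx
    exact ⟨_, ⟨a, rfl⟩, (Q.mem_imageBlock e a _).2 ⟨a, Q.1.refl a, rfl⟩⟩
  · rintro _ ⟨a, rfl⟩ _ ⟨b, rfl⟩ x hx hy
    obtain ⟨c, hc, rfl⟩ := (Q.mem_imageBlock e _ _).1 hx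
    obtain ⟨d, hd, h⟩ := (Q.mem_imageBlock e _ _).1 hy
    obtain rfl := e.injective h
    exact hblock _ _ (Q.1.trans (Q.1.symm hc) hd)
  · rintro _ ⟨a, rfl⟩ x hx y hy hxy
    obtain ⟨c, hc, rfl⟩ := (Q.mem_imageBlock e _ _).1 hx
    obtain ⟨d, -, rfl⟩ := Finset.mem_map.1 hy
    refine (Q.mem_imageBlock e _ _).2 ⟨d, Q.1.trans (Q.1.symm (hQ.2 ?_)) hc, rfl⟩
    rw [he]
    exact hxy
  · rintro _ ⟨u, rfl⟩ _ ⟨v, rfl⟩ a ha b hb c hc d hd hac hcb hbd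
    obtain ⟨a, ha', rfl⟩ := (Q.mem_imageBlock e _ _).1 ha
    obtain ⟨b, hb', rfl⟩ := (Q.mem_imageBlock e _ _).1 hb
    obtain ⟨c, hc', rfl⟩ := (Q.mem_imageBlock e _ _).1 hc
    obtain ⟨d, hd', rfl⟩ := (Q.mem_imageBlock e _ _).1 hd
    have := hQ.1 a b c d (e.lt_iff_lt.1 hac) (e.lt_iff_lt.1 hcb) (e.lt_iff_lt.1 hbd)
      (Q.1.trans ha' (Q.1.symm hb')) (Q.1.trans hc' (Q.1.symm hd'))
    exact hblock _ _ (Q.1.trans (Q.1.symm ha') (Q.1.trans this hc'))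

theorem Coarsening.rel_iff_family {P R : NCP} (e : Fin R.deg ↪o Fin P.deg) (Q : R.Coarsening)
    (a b : Fin R.deg) : Q.1 a b ↔ ∃ B ∈ Q.family e, e a ∈ B ∧ e b ∈ B := by
  simp only [Coarsening.mem_family]
  constructor
  · intro h
    exact ⟨_, ⟨b, rfl⟩, (Q.mem_imageBlock e _ _).2 ⟨a, h, rfl⟩,
      (Q.mem_imageBlock e _ _).2 ⟨b, Q.1.refl b, rfl⟩⟩
  · rintro ⟨_, ⟨c, rfl⟩, ha, hb⟩
    obtain ⟨a', ha', h1⟩ := (Q.mem_imageBlock e _ _).1 ha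
    obtain ⟨b', hb', h2⟩ := (Q.mem_imageBlock e _ _).1 hb
    obtain rfl := e.injective h1
    obtain rfl := e.injective h2
    exact Q.1.trans ha' (Q.1.symm hb')

theorem Coarsening.family_injective {P R : NCP} (e : Fin R.deg ↪o Fin P.deg) :
    Function.Injective (Coarsening.family e) := fun Q Q' h =>
  Subtype.ext (Setoid.ext fun a b => by
    rw [Q.rel_iff_family e, Q'.rel_iff_family e, h])

/-- The coarsening is the relation of lying in a common member of `π`: covering gives reflexivity,
disjointness transitivity, and saturation that it is coarser than `R`. -/
theorem IsNCFamily.exists_coarsening {P R : NCP} (e : Fin R.deg ↪o Fin P.deg)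
    (he : R.rel = P.rel.comap e) {π : Finset (Finset (Fin P.deg))}
    (hπ : P.IsNCFamily (Finset.univ.map e.toEmbedding) π) :
    ∃ Q : R.Coarsening, Q.family e = π := by
  have hmem : ∀ a : Fin R.deg, e a ∈ Finset.univ.map e.toEmbedding := fun a => by simp
  let r : Setoid (Fin R.deg) :=
    { r := fun a b => ∃ B ∈ π, e a ∈ B ∧ e b ∈ B
      iseqv := by
        refine ⟨fun a => ?_, ?_, ?_⟩
        · obtain ⟨B, hB, h⟩ := hπ.cover _ (hmem a)
          exact ⟨B, hB, h, h⟩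
        · rintro a b ⟨B, hB, h, h'⟩
          exact ⟨B, hB, h', h⟩
        · rintro a b c ⟨B, hB, h, h'⟩ ⟨C, hC, k, k'⟩
          obtain rfl := hπ.eq_of_mem _ hB _ hC _ h' k
          exact ⟨B, hB, h, k'⟩ }
  have hnc : IsNoncrossing r := by
    rintro a b c d hac hcb hbd ⟨B, hB, h, h'⟩ ⟨C, hC, k, k'⟩
    obtain rfl := hπ.noncrossing _ hB _ hC _ h _ h' _ k _ k' (e.lt_iff_lt.2 hac)
      (e.lt_iff_lt.2 hcb) (e.lt_iff_lt.2 hbd)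
    exact ⟨B, hB, h, k⟩
  have hle : R.rel ≤ r := by
    intro a b hab
    rw [he] at hab
    obtain ⟨B, hB, h⟩ := hπ.cover _ (hmem a)
    exact ⟨B, hB, h, hπ.saturated _ hB _ h _ (hmem b) hab⟩
  have hblock : ∀ (Q : R.Coarsening) (_ : Q.1 = r) (a : Fin R.deg) (B : Finset (Fin P.deg)),
      B ∈ π → e a ∈ B →
      Q.imageBlock e (Quotient.mk Q.1 a) = B := by
    intro Q hQ a B hB ha
    ext x
    rw [Q.mem_imageBlock, hQ]
    constructor
    · rintro ⟨b, ⟨C, hC, h, h'⟩, rfl⟩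
      rwa [hπ.eq_of_mem _ hB _ hC _ ha h']
    · intro hx
      obtain ⟨b, -, rfl⟩ := Finset.mem_map.1 (hπ.subset _ hB hx)
      exact ⟨b, ⟨B, hB, hx, ha⟩, rfl⟩
  let Q : R.Coarsening := ⟨r, hnc, hle⟩
  refine ⟨Q, ?_⟩
  ext B
  rw [Q.mem_family]
  constructor
  · rintro ⟨a, rfl⟩
    obtain ⟨B, hB, h⟩ := hπ.cover _ (hmem a)
    rwa [hblock Q rfl a B hB h]
  · intro hB
    obtain ⟨x, hx⟩ := hπ.nonempty _ hB
    obtain ⟨a, -, rfl⟩ := Finset.mem_map.1 (hπ.subset _ hB hx)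
    exact ⟨a, hblock Q rfl a B hB hx⟩

/-- Sums over coarsenings of `R`, which sits inside `P`, as sums over families of blocks. -/
theorem sum_coarsening {M : Type*} [CommSemiring M] {P R : NCP} (e : Fin R.deg ↪o Fin P.deg)
    (he : R.rel = P.rel.comap e) (f : NCP → M) (g : Finset (Fin P.deg) → M)
    (hg : ∀ B (hB : B.Nonempty), g B = f (P.restr B hB)) :
    ∑ Q : R.Coarsening, ∏ q : Quotient Q.toNCP.rel,
        f (R.restr (Q.toNCP.block q) (Q.toNCP.block_nonempty q))
      = ∑ π ∈ P.families (Finset.univ.map e.toEmbedding), ∏ B ∈ π, g B := by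
  classical
  refine Finset.sum_bij (fun Q _ => Q.family e) (fun Q _ => mem_families.2 (Q.isNCFamily e he))
    (fun Q _ Q' _ h => Coarsening.family_injective e h) (fun π hπ => ?_) (fun Q _ => ?_)
  · obtain ⟨Q, hQ⟩ := (mem_families.1 hπ).exists_coarsening e he
    exact ⟨Q, Finset.mem_univ _, hQ⟩
  · rw [Coarsening.family, Finset.prod_image (Q.imageBlock_injective e).injOn]
    -- Reindexing by the identity only reconciles the index types `Quotient Q.toNCP.rel` and
    -- `Quotient Q.1`.
    refine Finset.prod_bij (fun q _ => q) (fun q _ => Finset.mem_univ _) (fun _ _ _ _ h => h)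
      (fun q _ => ⟨q, Finset.mem_univ _, rfl⟩) fun q _ => ?_
    rw [hg _ (Q.imageBlock_nonempty e q)]
    exact congrArg f (Q.restr_block e he q)

/-- An empty gap thus contributes the factor `1`, in agreement with `st P ∅ = 1`. -/
theorem families_empty (P : NCP) : P.families ∅ = {∅} := by
  ext π
  rw [mem_families, Finset.mem_singleton]
  constructor
  · intro h
    rw [Finset.eq_empty_iff_forall_notMem]
    intro B hB
    obtain ⟨x, hx⟩ := h.nonempty B hB
    simpa using h.subset B hB hx
  · rintro rfl
    constructor <;> simp

/-! ### Gaps of a subset -/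

theorem mem_gap {n : ℕ} {L : Finset (Fin n)} {i : ℕ} {y : Fin n} :
    y ∈ gap L i ↔ y ∉ L ∧ (L.filter (· < y)).card = i := by
  simp [gap]

theorem card_filter_lt_mono {n : ℕ} (L : Finset (Fin n)) {x y : Fin n} (h : x ≤ y) :
    (L.filter (· < x)).card ≤ (L.filter (· < y)).card :=
  Finset.card_le_card (Finset.monotone_filter_right L fun _ _ hz => lt_of_lt_of_le hz h)

theorem card_filter_lt_strict {n : ℕ} {L : Finset (Fin n)} {x y z : Fin n} (hz : z ∈ L)
    (hxz : x < z) (hzy : z < y) : (L.filter (· < x)).card < (L.filter (· < y)).card := by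
  refine Finset.card_lt_card (Finset.ssubset_iff_subset_ne.2
    ⟨Finset.monotone_filter_right L fun _ _ h => h.trans (hxz.trans hzy), fun h => ?_⟩)
  have : z ∈ L.filter (· < x) := h ▸ Finset.mem_filter.2 ⟨hz, hzy⟩
  exact lt_asymm hxz (Finset.mem_filter.1 this).2

/-- Some `z` in `L` is counted below `y` but not below `x`, so `x ≤ z < y`; the first inequality is
strict because `x ∉ L`. This locates a point of `L` between two different gaps. -/
theorem exists_between_of_card_ne {n : ℕ} {L : Finset (Fin n)} {x y : Fin n} (hx : x ∉ L)
    (hxy : x ≤ y) (h : (L.filter (· < x)).card ≠ (L.filter (· < y)).card) :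
    ∃ z ∈ L, x < z ∧ z < y := by
  by_contra! hc
  refine h (congrArg _ (Finset.filter_congr fun z hz => ⟨fun h => lt_of_lt_of_le h hxy, fun h => ?_⟩))
  by_contra! hle
  exact absurd h (not_lt.2 (hc z hz (lt_of_le_of_ne hle fun he => hx (he ▸ hz))))

theorem gap_index_eq {n : ℕ} {L : Finset (Fin n)} {i j : ℕ} {x : Fin n} (hi : x ∈ gap L i)
    (hj : x ∈ gap L j) : i = j :=
  (mem_gap.1 hi).2.symm.trans (mem_gap.1 hj).2

theorem exists_mem_gap {n : ℕ} {L : Finset (Fin n)} {x : Fin n} (hx : x ∉ L) :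
    ∃ i : Fin (L.card + 1), x ∈ gap L i :=
  ⟨⟨_, Nat.lt_succ_of_le (Finset.card_filter_le L (· < x))⟩, mem_gap.2 ⟨hx, rfl⟩⟩

theorem notMem_of_between_gap {n : ℕ} {L : Finset (Fin n)} {i : ℕ} {x y z : Fin n}
    (hx : x ∈ gap L i) (hy : y ∈ gap L i) (hxz : x < z) (hzy : z < y) : z ∉ L := fun hz =>
  (card_filter_lt_strict hz hxz hzy).ne ((mem_gap.1 hx).2.trans (mem_gap.1 hy).2.symm)

theorem mem_gap_of_between {n : ℕ} {L : Finset (Fin n)} {i : ℕ} {x y z : Fin n}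
    (hx : x ∈ gap L i) (hy : y ∈ gap L i) (hxz : x < z) (hzy : z < y) : z ∈ gap L i := by
  refine mem_gap.2 ⟨notMem_of_between_gap hx hy hxz hzy, le_antisymm ?_ ?_⟩
  · rw [← (mem_gap.1 hy).2]
    exact card_filter_lt_mono L hzy.le
  · rw [← (mem_gap.1 hx).2]
    exact card_filter_lt_mono L hxz.le

theorem first_le (P : NCP) (x : Fin P.deg) : P.first ≤ x := Nat.zero_le _

theorem mem_cuts {P : NCP} {U : Finset (Fin P.deg)} : U ∈ P.cuts ↔ P.IsUpperset U := by
  simp [cuts]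

theorem IsUpperset.notMem_of_rel {P : NCP} {U : Finset (Fin P.deg)} (hU : P.IsUpperset U)
    {x y : Fin P.deg} (hx : x ∉ U) (h : P.rel x y) : y ∉ U := fun hy =>
  hx (hU y hy x ⟨y, y, y, P.rel.refl y, P.rel.refl y, h, le_rfl, le_rfl⟩)

/-- A block of `P` outside a lowerset lies in a single gap of it. -/
theorem IsUpperset.mem_gap_of_rel {P : NCP} {U : Finset (Fin P.deg)} (hU : P.IsUpperset U)
    {x y : Fin P.deg} {i : ℕ} (hx : x ∈ gap Uᶜ i) (h : P.rel x y) : y ∈ gap Uᶜ i := by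
  have hxU : x ∈ U := by simpa using (mem_gap.1 hx).1
  have hyU : y ∈ U := hU x hxU y ⟨y, y, y, h, h, P.rel.refl y, le_rfl, le_rfl⟩
  -- A point of the lowerset strictly between `u` and `v` would lie in the convex hull of their
  -- block, which the upperset condition forbids.
  have key : ∀ u v, P.rel u v → u ∈ U → u ≤ v →
      (Uᶜ.filter (· < u)).card = (Uᶜ.filter (· < v)).card := by
    intro u v huv hu hle
    by_contra hne
    obtain ⟨z, hz, h1, h2⟩ := exists_between_of_card_ne (by simpa using hu) hle hne
    exact Finset.mem_compl.1 hz
      (hU u hu z ⟨u, v, z, P.rel.refl u, huv, P.rel.refl z, h1.le, h2.le⟩)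
  refine mem_gap.2 ⟨by simpa using hyU, ?_⟩
  rw [← (mem_gap.1 hx).2]
  rcases le_total x y with hle | hle
  · exact (key x y h hxU hle).symm
  · exact key y x (P.rel.symm h) hyU hle

/-! ### Splitting off the block of the first element -/

open Classical in
/-- The complement of the block of the first element. -/
def coFirst (P : NCP) (π : Finset (Finset (Fin P.deg))) : Finset (Fin P.deg) :=
  (Finset.univ.filter fun x => ∃ B ∈ π, P.first ∈ B ∧ x ∈ B)ᶜ

theorem IsNCFamily.compl_coFirst_eq {P : NCP} {π : Finset (Finset (Fin P.deg))}
    (hπ : P.IsNCFamily Finset.univ π) {B : Finset (Fin P.deg)} (hB : B ∈ π) (h : P.first ∈ B) :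
    (P.coFirst π)ᶜ = B := by
  ext x
  simp only [coFirst, compl_compl, Finset.mem_filter, Finset.mem_univ, true_and]
  constructor
  · rintro ⟨C, hC, h1, h2⟩
    rwa [hπ.eq_of_mem _ hB _ hC _ h h1]
  · exact fun hx => ⟨B, hB, h, hx⟩

theorem IsNCFamily.coFirst_eq_iff {P : NCP} {π : Finset (Finset (Fin P.deg))}
    (hπ : P.IsNCFamily Finset.univ π) {U : Finset (Fin P.deg)} (hU : P.first ∈ Uᶜ) :
    P.coFirst π = U ↔ Uᶜ ∈ π := by
  constructor
  · rintro rfl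
    obtain ⟨B, hB, h⟩ := hπ.cover P.first (Finset.mem_univ _)
    rwa [hπ.compl_coFirst_eq hB h]
  · intro h
    rw [← compl_inj_iff, hπ.compl_coFirst_eq h hU]

/-- Let `B` be the block of the first element. If the hull of a block of `P` inside another member
`C` met `B`, there would be `first < x < z < y` with `first, z ∈ B` and `x, y ∈ C`, a crossing.
Minimality of the first element supplies the leftmost point. -/
theorem IsNCFamily.coFirst_mem {P : NCP} {π : Finset (Finset (Fin P.deg))}
    (hπ : P.IsNCFamily Finset.univ π) :
    P.IsUpperset (P.coFirst π) ∧ P.first ∈ (P.coFirst π)ᶜ := by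
  obtain ⟨B, hB, h⟩ := hπ.cover P.first (Finset.mem_univ _)
  have hc := hπ.compl_coFirst_eq hB h
  refine ⟨?_, hc ▸ h⟩
  rw [← compl_inj_iff, compl_compl] at hc
  rw [hc]
  rintro a ha b ⟨x, y, z, hax, hay, hbz, hxz, hzy⟩
  rw [Finset.mem_compl] at ha ⊢
  intro hb
  obtain ⟨C, hC, haC⟩ := hπ.cover a (Finset.mem_univ _)
  have hx := hπ.saturated _ hC _ haC x (Finset.mem_univ _) hax
  have hy := hπ.saturated _ hC _ haC y (Finset.mem_univ _) hay
  have hz := hπ.saturated _ hB _ hb z (Finset.mem_univ _) hbz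
  have hne : ∀ w ∈ C, w ∉ B := fun w hw hw' => ha (hπ.eq_of_mem _ hC _ hB _ hw hw' ▸ haC)
  refine ha (hπ.noncrossing _ hB _ hC _ h _ hz _ hx _ hy ?_ ?_ ?_ ▸ haC)
  · exact lt_of_le_of_ne (P.first_le x) fun he => hne x hx (he ▸ h)
  · exact lt_of_le_of_ne hxz fun he => hne x hx (he ▸ hz)
  · exact lt_of_le_of_ne hzy fun he => hne y hy (he ▸ hz)

/-- A member with points in two gaps would have a point of `L` strictly between them; together with
the first element, which lies in `L`, this is a crossing. -/
theorem IsNCFamily.subset_gap {P : NCP} {π : Finset (Finset (Fin P.deg))}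
    (hπ : P.IsNCFamily Finset.univ π) {L B : Finset (Fin P.deg)} (hL : L ∈ π) (hf : P.first ∈ L)
    (hB : B ∈ π) {i : ℕ} {x : Fin P.deg} (hx : x ∈ B) (hxi : x ∈ gap L i) : B ⊆ gap L i := by
  have hne : ∀ w ∈ B, w ∉ L := fun w hw hw' =>
    (mem_gap.1 hxi).1 (hπ.eq_of_mem _ hB _ hL _ hw hw' ▸ hx)
  have key : ∀ u ∈ B, ∀ v ∈ B, u ≤ v → (L.filter (· < u)).card = (L.filter (· < v)).card := by
    intro u hu v hv hle
    by_contra h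
    obtain ⟨z, hz, h1, h2⟩ := exists_between_of_card_ne (hne u hu) hle h
    have := hπ.noncrossing _ hL _ hB _ hf _ hz _ hu _ hv
      (lt_of_le_of_ne (P.first_le u) fun he => hne u hu (he ▸ hf)) h1 h2
    exact hne u hu (this ▸ hu)
  intro y hy
  refine mem_gap.2 ⟨hne y hy, ?_⟩
  rw [← (mem_gap.1 hxi).2]
  rcases le_total x y with hle | hle
  · exact (key x hx y hy hle).symm
  · exact key y hy x hx hle

theorem IsNCFamily.filter_gap {P : NCP} {π : Finset (Finset (Fin P.deg))}
    (hπ : P.IsNCFamily Finset.univ π) {L : Finset (Fin P.deg)} (hL : L ∈ π) (hf : P.first ∈ L)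
    (i : ℕ) : P.IsNCFamily (gap L i) (π.filter (· ⊆ gap L i)) := by
  constructor
  all_goals simp only [Finset.mem_filter]
  · exact fun B hB => hπ.nonempty B hB.1
  · exact fun B hB => hB.2
  · intro x hx
    obtain ⟨B, hB, h⟩ := hπ.cover x (Finset.mem_univ _)
    exact ⟨B, ⟨hB, hπ.subset_gap hL hf hB h hx⟩, h⟩
  · exact fun B hB C hC => hπ.eq_of_mem B hB.1 C hC.1
  · exact fun B hB x hx y _ => hπ.saturated B hB.1 x hx y (Finset.mem_univ _)
  · exact fun B hB C hC => hπ.noncrossing B hB.1 C hC.1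

/-- Saturation is where the cut condition enters: blocks of `P` respect `Uᶜ` and its gaps. No
crossing arises, since gaps are convex, pairwise disjoint and free of points of `Uᶜ` between their
elements. -/
theorem IsUpperset.isNCFamily_insert {P : NCP} {U : Finset (Fin P.deg)} (hU : P.IsUpperset U)
    (hf : P.first ∈ Uᶜ) {p : Fin (Uᶜ.card + 1) → Finset (Finset (Fin P.deg))}
    (hp : ∀ i : Fin _, P.IsNCFamily (gap Uᶜ i) (p i)) :
    P.IsNCFamily Finset.univ (insert Uᶜ (Finset.univ.biUnion p)) := by
  have hnot : ∀ {i B x}, B ∈ p i → x ∈ B → x ∉ Uᶜ := fun hB hx =>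
    (mem_gap.1 ((hp _).subset _ hB hx)).1
  constructor
  all_goals simp only [Finset.mem_insert, Finset.mem_biUnion, Finset.mem_univ, true_and]
  · rintro B (rfl | ⟨i, hB⟩)
    · exact ⟨_, hf⟩
    · exact (hp i).nonempty B hB
  · exact fun B _ => Finset.subset_univ B
  · rintro x -
    by_cases hx : x ∈ Uᶜ
    · exact ⟨_, Or.inl rfl, hx⟩
    · obtain ⟨i, hi⟩ := exists_mem_gap hx
      obtain ⟨B, hB, h⟩ := (hp i).cover x hi
      exact ⟨B, Or.inr ⟨i, hB⟩, h⟩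
  · rintro B (rfl | ⟨i, hB⟩) C (rfl | ⟨j, hC⟩) x hx hx'
    · rfl
    · exact absurd hx (hnot hC hx')
    · exact absurd hx' (hnot hB hx)
    · obtain rfl := Fin.ext (gap_index_eq ((hp i).subset _ hB hx) ((hp j).subset _ hC hx'))
      exact (hp i).eq_of_mem _ hB _ hC _ hx hx'
  · rintro B (rfl | ⟨i, hB⟩) x hx y - hxy
    · rw [Finset.mem_compl] at hx ⊢
      exact hU.notMem_of_rel hx hxy
    · exact (hp i).saturated _ hB _ hx _ (hU.mem_gap_of_rel ((hp i).subset _ hB hx) hxy) hxy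
  · rintro B (rfl | ⟨i, hB⟩) C (rfl | ⟨j, hC⟩) a ha b hb c hc d hd hac hcb hbd
    · rfl
    · exact absurd hb
        (notMem_of_between_gap ((hp j).subset _ hC hc) ((hp j).subset _ hC hd) hcb hbd)
    · exact absurd hc
        (notMem_of_between_gap ((hp i).subset _ hB ha) ((hp i).subset _ hB hb) hac hcb)
    · have hci := mem_gap_of_between ((hp i).subset _ hB ha) ((hp i).subset _ hB hb) hac hcb
      obtain rfl := Fin.ext (gap_index_eq hci ((hp j).subset _ hC hc))
      exact (hp i).noncrossing _ hB _ hC _ ha _ hb _ hc _ hd hac hcb hbd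

theorem IsNCFamily.insert_biUnion_filter {P : NCP} {π : Finset (Finset (Fin P.deg))}
    (hπ : P.IsNCFamily Finset.univ π) {L : Finset (Fin P.deg)} (hL : L ∈ π) (hf : P.first ∈ L) :
    insert L (Finset.univ.biUnion fun i : Fin (L.card + 1) => π.filter (· ⊆ gap L i)) = π := by
  ext B
  simp only [Finset.mem_insert, Finset.mem_biUnion, Finset.mem_univ, true_and, Finset.mem_filter]
  constructor
  · rintro (rfl | ⟨i, h, -⟩)
    · exact hL
    · exact h
  · intro hB
    obtain ⟨x, hx⟩ := hπ.nonempty B hB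
    by_cases hxL : x ∈ L
    · exact Or.inl (hπ.eq_of_mem _ hB _ hL _ hx hxL)
    · obtain ⟨i, hi⟩ := exists_mem_gap hxL
      exact Or.inr ⟨i, hB, hπ.subset_gap hL hf hB hx hi⟩

theorem filter_insert_biUnion {P : NCP} {L : Finset (Fin P.deg)} (hf : P.first ∈ L)
    {p : Fin (L.card + 1) → Finset (Finset (Fin P.deg))}
    (hp : ∀ i : Fin _, P.IsNCFamily (gap L i) (p i)) (i : Fin (L.card + 1)) :
    (insert L (Finset.univ.biUnion p)).filter (· ⊆ gap L i) = p i := by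
  ext B
  simp only [Finset.mem_insert, Finset.mem_biUnion, Finset.mem_univ, true_and, Finset.mem_filter]
  constructor
  · rintro ⟨rfl | ⟨j, hB⟩, h⟩
    · exact absurd hf (mem_gap.1 (h hf)).1
    · obtain ⟨x, hx⟩ := (hp j).nonempty B hB
      obtain rfl := Fin.ext (gap_index_eq (h hx) ((hp j).subset _ hB hx))
      exact hB
  · exact fun hB => ⟨Or.inr ⟨i, hB⟩, (hp i).subset B hB⟩

theorem prod_insert_biUnion {M : Type*} [CommMonoid M] {P : NCP} {L : Finset (Fin P.deg)}
    (hf : P.first ∈ L) {p : Fin (L.card + 1) → Finset (Finset (Fin P.deg))}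
    (hp : ∀ i : Fin _, P.IsNCFamily (gap L i) (p i)) (g : Finset (Fin P.deg) → M) :
    ∏ B ∈ insert L (Finset.univ.biUnion p), g B = g L * ∏ i, ∏ B ∈ p i, g B := by
  rw [Finset.prod_insert, Finset.prod_biUnion]
  · intro i _ j _ hij
    rw [Function.onFun, Finset.disjoint_left]
    intro B hi hj
    obtain ⟨x, hx⟩ := (hp i).nonempty B hi
    exact hij (Fin.ext (gap_index_eq ((hp i).subset _ hi hx) ((hp j).subset _ hj hx)))
  · intro h
    obtain ⟨i, -, hi⟩ := Finset.mem_biUnion.1 h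
    exact (mem_gap.1 ((hp i).subset _ hi hf)).1 hf

/-- A noncrossing partition coarser than `P` amounts to a cut, whose lowerset is the block of the
first element, and noncrossing partitions of the gaps of the lowerset. -/
theorem sum_families_univ {M : Type*} [CommSemiring M] (P : NCP) (g : Finset (Fin P.deg) → M) :
    ∑ π ∈ P.families Finset.univ, ∏ B ∈ π, g B
      = ∑ U ∈ P.cuts with P.first ∈ Uᶜ, g Uᶜ *
          ∏ i : Fin (Uᶜ.card + 1), ∑ π ∈ P.families (gap Uᶜ i), ∏ B ∈ π, g B := by
  classical
  -- The families are grouped by the cut whose lowerset is the block of the first element; the fibre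
  -- over `U` consists of those with `Uᶜ` as a member.
  rw [← Finset.sum_fiberwise_of_maps_to (g := P.coFirst)
    (t := P.cuts.filter fun U => P.first ∈ Uᶜ) (fun π hπ => by
      have h := (mem_families.1 hπ).coFirst_mem
      exact Finset.mem_filter.2 ⟨mem_cuts.2 h.1, h.2⟩)]
  refine Finset.sum_congr rfl fun U hU => ?_
  obtain ⟨hU, hf⟩ := Finset.mem_filter.1 hU
  rw [mem_cuts] at hU
  -- Expanding the product turns the right side into a sum over choices of one family per gap, ready
  -- for the bijection.
  rw [Finset.prod_univ_sum, Finset.mul_sum]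
  have hmem : ∀ π, π ∈ (P.families Finset.univ).filter (fun π => P.coFirst π = U) ↔
      P.IsNCFamily Finset.univ π ∧ Uᶜ ∈ π := fun π => by
    rw [Finset.mem_filter, mem_families]
    exact and_congr_right fun h => h.coFirst_eq_iff hf
  have hpi : ∀ p : Fin (Uᶜ.card + 1) → Finset (Finset (Fin P.deg)),
      p ∈ Fintype.piFinset (fun i : Fin (Uᶜ.card + 1) => P.families (gap Uᶜ i)) ↔
        ∀ i : Fin _, P.IsNCFamily (gap Uᶜ i) (p i) := fun p => by
    simp only [Fintype.mem_piFinset, mem_families]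
  refine Finset.sum_bij' (fun π _ i => π.filter (· ⊆ gap Uᶜ i))
    (fun p _ => insert Uᶜ (Finset.univ.biUnion p)) ?_ ?_ ?_ ?_ ?_
  · intro π hπ
    rw [hmem] at hπ
    exact (hpi _).2 fun i => hπ.1.filter_gap hπ.2 hf i
  · intro p hp
    exact (hmem _).2 ⟨hU.isNCFamily_insert hf ((hpi _).1 hp), Finset.mem_insert_self _ _⟩
  · intro π hπ
    rw [hmem] at hπ
    exact hπ.1.insert_biUnion_filter hπ.2 hf
  · intro p hp
    exact funext fun i => filter_insert_biUnion hf ((hpi _).1 hp) i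
  · intro π hπ
    rw [hmem] at hπ
    rw [← prod_insert_biUnion hf (fun i => hπ.1.filter_gap hπ.2 hf i) g,
      hπ.1.insert_biUnion_filter hπ.2 hf]

end NCP

/-! ### The fixpoint equation for characters -/

variable {𝕂 : Type*} [Field 𝕂]

/-- The left half-shuffle fixpoint equation, for a character, on partitions. -/
theorem isLeftFixpoint_iff (κ : InfChar 𝕂) (φ : CharH 𝕂) :
    IsLeftFixpoint κ.1 φ.toLinearMap ↔ ∀ P, φ (FreeAlgebra.ι 𝕂 P) = fixStep κ φ P := by
  -- On a nonempty word the counit vanishes and `κ ≺ φ` splits off its value on the first letter, so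
  -- multiplicativity of `φ` reduces the equation to letters.
  have hword : ∀ (P : NCP) (v : FreeMonoid NCP),
      ((counitH 𝕂).toLinearMap + leftShuffle κ.1 φ.toLinearMap)
        (FreeAlgebra.basisFreeMonoid 𝕂 NCP (FreeMonoid.of P * v))
          = fixStep κ φ P * φ (FreeAlgebra.basisFreeMonoid 𝕂 NCP v) := fun P v => by
    rw [LinearMap.add_apply, leftShuffle_word, AlgHom.toLinearMap_apply, counitH_basis]
    simp
  constructor
  · intro h P
    have h1 := LinearMap.congr_fun h (FreeAlgebra.basisFreeMonoid 𝕂 NCP (FreeMonoid.of P * 1))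
    rw [hword] at h1
    simpa [basisFreeMonoid_apply] using h1
  · intro h
    refine (FreeAlgebra.basisFreeMonoid 𝕂 NCP).ext fun w => ?_
    induction w using FreeMonoid.casesOn with
    | one =>
      have h0 : leftCoprod 𝕂 (FreeAlgebra.basisFreeMonoid 𝕂 NCP 1) = 0 := by
        simp only [leftCoprod, Module.Basis.constr_basis]
        rfl
      simp only [LinearMap.add_apply, leftShuffle, LinearMap.comp_apply, h0]
      simp [basisFreeMonoid_apply]
    | of_mul P v =>
      rw [hword, ← h P, AlgHom.toLinearMap_apply, ← map_mul]
      simp [basisFreeMonoid_apply]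

/-- Induction on the degree: the right side of the equation at `P` involves `φ` only on partitions
of smaller degree. -/
theorem IsLeftFixpoint.unique {κ : InfChar 𝕂} {φ χ : CharH 𝕂}
    (hφ : IsLeftFixpoint κ.1 φ.toLinearMap) (hχ : IsLeftFixpoint κ.1 χ.toLinearMap) : φ = χ := by
  rw [isLeftFixpoint_iff] at hφ hχ
  have key : ∀ n, ∀ P : NCP, P.deg < n → φ (FreeAlgebra.ι 𝕂 P) = χ (FreeAlgebra.ι 𝕂 P) := by
    intro n
    induction n with
    | zero => exact fun P hP => absurd hP (Nat.not_lt_zero _)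
    | succ n ih =>
      intro P hP
      rw [hφ, hχ]
      exact fixStep_congr κ φ χ P fun Q hQ => ih Q (by omega)
  exact FreeAlgebra.hom_ext (funext fun P => key _ P (Nat.lt_succ_self _))

theorem leftExp_spec (κ : InfChar 𝕂) : IsLeftFixpoint κ.1 (leftExp κ).toLinearMap :=
  (exists_leftFixpoint κ).choose_spec

/-! ### The universal character -/

theorem NCP.numBlocks_restr_eq_one_iff (P : NCP) (S : Finset (Fin P.deg)) (hS : S.Nonempty) :
    (P.restr S hS).numBlocks = 1 ↔ ∀ x ∈ S, ∀ y ∈ S, P.rel x y := by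
  rw [NCP.numBlocks, Nat.card_eq_one_iff_unique]
  constructor
  · rintro ⟨h, -⟩ x hx y hy
    rw [← Finset.mem_coe, ← Finset.range_orderEmbOfFin S rfl] at hx hy
    obtain ⟨a, rfl⟩ := hx
    obtain ⟨b, rfl⟩ := hy
    exact Quotient.exact (s := (P.restr S hS).rel)
      (h.elim (Quotient.mk (P.restr S hS).rel a) (Quotient.mk (P.restr S hS).rel b))
  · intro h
    refine ⟨⟨fun p q => ?_⟩, ⟨Quotient.mk (P.restr S hS).rel (P.restr S hS).first⟩⟩
    induction p using Quotient.inductionOn with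
    | _ a =>
      induction q using Quotient.inductionOn with
      | _ b =>
        exact Quotient.sound (s := (P.restr S hS).rel)
          (h _ (Finset.orderEmbOfFin_mem S rfl a) _ (Finset.orderEmbOfFin_mem S rfl b))

open Classical in
theorem unitInfChar_st (P : NCP) (S : Finset (Fin P.deg)) (hS : S.Nonempty) :
    (unitInfChar 𝕂).1 (st P S) = if ∀ x ∈ S, ∀ y ∈ S, P.rel x y then 1 else 0 := by
  have h : ∀ R : NCP, (unitInfChar 𝕂).1 (FreeAlgebra.ι 𝕂 R) = if R.numBlocks = 1 then 1 else 0 := by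
    intro R
    have h1 := DFunLike.congr_fun (Theta_thetaInv (hat (counitB 𝕂))) (FreeAlgebra.ι 𝕂 R)
    simpa [Theta, hat, counitB, unitInfChar] using h1
  rw [st, dif_pos hS, h]
  simp only [NCP.numBlocks_restr_eq_one_iff]

open Classical in
/-- The complement of the block of the first element is an upperset. -/
theorem NCP.isUpperset_compl_block_first (P : NCP) :
    P.IsUpperset (Finset.univ.filter fun x => ¬ P.rel P.first x) := by
  rintro a ha b ⟨x, y, z, hax, hay, hbz, hxz, hzy⟩
  simp only [Finset.mem_filter, Finset.mem_univ, true_and] at ha ⊢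
  intro hb
  have hne : ∀ w, P.rel a w → ¬ P.rel P.first w := fun w hw h =>
    ha (P.rel.trans h (P.rel.symm hw))
  have hz := P.rel.trans hb hbz
  refine hne x hax (P.noncrossing P.first z x y ?_ ?_ ?_ hz (P.rel.trans (P.rel.symm hax) hay))
  · exact lt_of_le_of_ne (P.first_le x) fun he => hne x hax (he ▸ P.rel.refl _)
  · exact lt_of_le_of_ne hxz fun he => hne x hax (he ▸ hz)
  · exact lt_of_le_of_ne hzy fun he => hne y hay (he ▸ hz)

/-- The universal character takes the value `1` on all partitions. -/
theorem psiLeft_ι (P : NCP) : psiLeft 𝕂 (FreeAlgebra.ι 𝕂 P) = 1 := by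
  classical
  have hone : IsLeftFixpoint (unitInfChar 𝕂).1
      (FreeAlgebra.lift 𝕂 fun _ : NCP => (1 : 𝕂)).toLinearMap := by
    rw [isLeftFixpoint_iff]
    intro P
    have hst : ∀ S, (FreeAlgebra.lift 𝕂 fun _ : NCP => (1 : 𝕂)) (st P S) = 1 := fun S => by
      rw [st]
      split_ifs <;> simp
    have hgap : ∀ U, (FreeAlgebra.lift 𝕂 fun _ : NCP => (1 : 𝕂)) (gapMonomial P U) = 1 := fun U => by
      rw [gapMonomial, map_list_prod, List.map_map]
      exact List.prod_eq_one fun x hx => by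
        obtain ⟨i, -, rfl⟩ := List.mem_map.1 hx
        exact hst _
    -- A lowerset is a union of blocks. If it contains the first element and `e` does not vanish on
    -- it, it lies within one block, hence is the block of the first element.
    rw [FreeAlgebra.lift_ι_apply, fixStep,
      Finset.sum_eq_single (Finset.univ.filter fun x => ¬ P.rel P.first x)]
    · rw [hgap, unitInfChar_st _ _ ⟨P.first, by simp⟩, if_pos, one_mul]
      intro x hx y hy
      simp only [Finset.mem_compl, Finset.mem_filter, Finset.mem_univ, true_and, not_not] at hx hy
      exact P.rel.trans (P.rel.symm hx) hy
    · intro U hU hne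
      obtain ⟨hU, hf⟩ := Finset.mem_filter.1 hU
      rw [unitInfChar_st _ _ ⟨_, hf⟩, if_neg, zero_mul]
      intro h
      refine hne (Finset.ext fun x => ?_)
      simp only [Finset.mem_filter, Finset.mem_univ, true_and]
      constructor
      · intro hx hr
        exact (NCP.mem_cuts.1 hU).notMem_of_rel (Finset.mem_compl.1 hf) hr hx
      · intro hx
        by_contra hxU
        exact hx (h _ hf _ (Finset.mem_compl.2 hxU))
    · intro h
      refine absurd (Finset.mem_filter.2 ⟨NCP.mem_cuts.2 P.isUpperset_compl_block_first, ?_⟩) h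
      simp
  have h := (leftExp_spec (unitInfChar 𝕂)).unique hone
  rw [psiLeft, h, FreeAlgebra.lift_ι_apply]

/-! ### The action on the universal character solves the equation -/

/-- The action of a character of `BBl` on a character of `HGap`, as a character. -/
def actChar (α : CharH 𝕂) (φ : CharB 𝕂) : CharH 𝕂 :=
  ((Algebra.TensorProduct.lmul' 𝕂 (S := 𝕂)).comp (Algebra.TensorProduct.map α φ)).comp (coaction 𝕂)

theorem actChar_toLinearMap (α : CharH 𝕂) (φ : CharB 𝕂) :
    (actChar α φ).toLinearMap = act α.toLinearMap φ := by
  have h : LinearMap.mul' 𝕂 𝕂 ∘ₗ TensorProduct.map α.toLinearMap φ.toLinearMap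
      = ((Algebra.TensorProduct.lmul' 𝕂 (S := 𝕂)).comp
          (Algebra.TensorProduct.map α φ)).toLinearMap := by
    ext <;> simp
  rw [act, ← LinearMap.comp_assoc, h]
  rfl

/-- `ψ_≺ ↶ K` sums, over the coarsenings of a partition, the products of the values on blocks. -/
theorem actChar_psiLeft_ι (κ : InfChar 𝕂) (P : NCP) :
    actChar (psiLeft 𝕂) (bar (Theta κ)) (FreeAlgebra.ι 𝕂 P)
      = ∑ Q : P.Coarsening, ∏ q : Quotient Q.toNCP.rel,
          κ.1 (FreeAlgebra.ι 𝕂 (P.restr (Q.toNCP.block q) (Q.toNCP.block_nonempty q))) := by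
  simp only [actChar, AlgHom.comp_apply, coaction, FreeAlgebra.lift_ι_apply, map_sum,
    Algebra.TensorProduct.map_tmul, Algebra.TensorProduct.lmul'_apply_tmul]
  refine Finset.sum_congr rfl fun Q _ => ?_
  rw [psiLeft_ι, one_mul, fibre, map_prod]
  refine Finset.prod_congr rfl fun q _ => ?_
  rw [bar, MvPolynomial.aeval_X, Theta, FreeAlgebra.lift_ι_apply]

/-- This evaluates the character on each gap, possibly empty, in terms of subsets of the ambient
`Fin P.deg`, as the recursion over cuts requires. -/
theorem actChar_psiLeft_st (κ : InfChar 𝕂) (P : NCP) (S : Finset (Fin P.deg)) :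
    actChar (psiLeft 𝕂) (bar (Theta κ)) (st P S)
      = ∑ π ∈ P.families S, ∏ B ∈ π, κ.1 (st P B) := by
  by_cases hS : S.Nonempty
  · rw [st, dif_pos hS, actChar_psiLeft_ι,
      NCP.sum_coarsening (P := P) (R := P.restr S hS) (S.orderEmbOfFin rfl) rfl
        (fun R => κ.1 (FreeAlgebra.ι 𝕂 R)) (fun B => κ.1 (st P B))
        (fun B hB => by rw [st, dif_pos hB])]
    have h : Finset.map (S.orderEmbOfFin rfl).toEmbedding Finset.univ = S := by
      rw [← Finset.coe_inj, Finset.coe_map, Finset.coe_univ, Set.image_univ]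
      exact Finset.range_orderEmbOfFin S rfl
    exact congrArg (fun T => ∑ π ∈ P.families T, ∏ B ∈ π, κ.1 (st P B)) h
  · rw [Finset.not_nonempty_iff_eq_empty] at hS
    subst hS
    simp [st, NCP.families_empty]

theorem isLeftFixpoint_actChar (κ : InfChar 𝕂) :
    IsLeftFixpoint κ.1 (actChar (psiLeft 𝕂) (bar (Theta κ))).toLinearMap := by
  rw [isLeftFixpoint_iff]
  intro P
  rw [actChar_psiLeft_ι, NCP.sum_coarsening (RelEmbedding.refl _) rfl
    (fun R => κ.1 (FreeAlgebra.ι 𝕂 R)) (fun B => κ.1 (st P B))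
    (fun B hB => by rw [st, dif_pos hB])]
  have h : Finset.map (RelEmbedding.refl ((· ≤ ·) : Fin P.deg → Fin P.deg → Prop)).toEmbedding
      Finset.univ = Finset.univ := by ext; simp
  rw [h, NCP.sum_families_univ, fixStep]
  refine Finset.sum_congr rfl fun U _ => congrArg _ ?_
  -- The character sends the ordered gap monomial to a product in the field, which is compared with
  -- the product over `Fin (Uᶜ.card + 1)` through `Finset.range`.
  rw [gapMonomial, map_list_prod, List.map_map, ← Finset.prod_range
    (fun i => ∑ π ∈ P.families (NCP.gap Uᶜ i), ∏ B ∈ π, κ.1 (st P B))]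
  refine (Finset.prod_congr rfl fun i _ => (actChar_psiLeft_st κ P _).symm).trans ?_
  exact Multiset.prod_coe _

end NoncrossingHopf

end

theorem mainTheorem3 {𝕂 : Type*} [Field 𝕂] [CharZero 𝕂] (κ : NoncrossingHopf.InfChar 𝕂) :
    (∀ φ : NoncrossingHopf.CharH 𝕂,
      NoncrossingHopf.IsLeftFixpoint κ.1 φ.toLinearMap ↔
        φ.toLinearMap =
          NoncrossingHopf.act (NoncrossingHopf.psiLeft 𝕂).toLinearMap
            (NoncrossingHopf.bar (NoncrossingHopf.Theta κ))) ∧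
    (NoncrossingHopf.leftExp κ).toLinearMap =
      NoncrossingHopf.act (NoncrossingHopf.psiLeft 𝕂).toLinearMap
        (NoncrossingHopf.bar (NoncrossingHopf.Theta κ)) := by
  have hfix := NoncrossingHopf.isLeftFixpoint_actChar κ
  rw [← NoncrossingHopf.actChar_toLinearMap]
  refine ⟨fun φ => ⟨fun h => by rw [h.unique hfix], fun h => by rw [h]; exact hfix⟩, ?_⟩
  rw [(NoncrossingHopf.leftExp_spec κ).unique hfix]
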